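/- Let $\mathcal X\subset\mathbb R^d$, $\mathcal Z\subset\mathbb R^{d_z}$, $\Phi\subset\mathbb R^{d_\phi}$, $\Theta\subset\mathbb R^{d_\theta}$, let $K,n\ge 1$ be integers, and let $\Delta>0$ be such that $\sup_{x,x'\in\mathcal X}\|x-x'\|<\Delta^{1/2}$ (Euclidean norm). Let $\mathcal D$ be a probability distribution on $\mathcal X$. Let $q(J\mid\mathbf e,\phi,x)$ be the (deterministic or stochastic) encoder posterior, a Markov kernel giving for every codebook $\mathbf e=(e_1,\dots,e_K)\in\mathcal Z^K$, every $\phi\in\Phi$ and $x\in\mathcal X$ a distribution on the latent indices $\{1,\dots,K\}$; let $g_\theta:\mathcal Z\to\mathcal X$, $\theta\in\Theta$, be the decoder (measurable in $(\theta,z)$); and let $q(\mathbf e,\phi,\theta\mid S)$ be a randomized learning algorithm, i.e. a Markov kernel from $\mathcal X^n$ to $\mathcal W=\mathcal Z^K\times\Phi\times\Theta$. For $w=(\mathbf e,\phi,\theta)$ put $l_0(w,x)=\mathbb E_{q(J\mid\mathbf e,\phi,x)}\|x-g_\theta(e_J)\|^2$ and define the generalization error $$\mathrm{gen}(n,\mathcal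 D)=\Big|\mathbb E_{S,X}\,\mathbb E_{q(W\mid S)}\Big[l_0(W,X)-\frac1n\sum_{m=1}^n l_0(W,S_m)\Big]\Big|,$$ where $S=(S_1,\dots,S_n)\sim\mathcal D^{n}$ and $X\sim\mathcal D$ is independent of $(S,W)$. Let $\tilde X=(\tilde X_1,\dots,\tilde X_{2n})\sim\mathcal D^{2n}$ and let $\mathbf T=(T_1,\dots,T_{2n})$ be a uniformly random permutation of $\{1,\dots,2n\}$ independent of $\tilde X$; let $\tilde X_{\mathbf T_0}=(\tilde X_{T_1},\dots,\tilde X_{T_n})$ be the test dataset and $\tilde X_{\mathbf T_1}=(\tilde X_{T_{n+1}},\dots,\tilde X_{T_{2n}})$ the training dataset. For given $\tilde X,\mathbf e,\phi$, let $$\mathbf Q_{\tilde{\mathbf J},\mathbf T}=\prod_{m=1}^n q(\bar J_m\mid\mathbf e,\phi,\tilde X_{T_m})\ \prod_{m=1}^n q(J_m\mid\mathbf e,\phi,\tilde X_{T_{n+m}}),\qquad \mathbf Q_{\tilde{\mathbf J}}=\mathbb E_{\mathbf T}\,\mathbf Q_{\tilde{\mathbf J},\mathbf T},$$ distributions on $\{1,\dots,K\}^{n}\times\{1,\dots,K\}^{n}$,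 where $\mathbb E_{\mathbf T}$ averages over all $(2n)!$ permutations. Then $\mathbb E_{\tilde X,\mathbf T}\,\mathbb E_{q(\mathbf e,\phi\mid\tilde X_{\mathbf T_1})}\mathrm{KL}(\mathbf Q_{\tilde{\mathbf J},\mathbf T}\,\|\,\mathbf Q_{\tilde{\mathbf J}})$ is finite and $$\mathrm{gen}(n,\mathcal D)\le 3\Delta\sqrt{\frac{\mathbb E_{\tilde X,\mathbf T}\,\mathbb E_{q(\mathbf e,\phi\mid\tilde X_{\mathbf T_1})}\mathrm{KL}(\mathbf Q_{\tilde{\mathbf J},\mathbf T}\,\|\,\mathbf Q_{\tilde{\mathbf J}})}{n}}+\frac{\Delta}{\sqrt n}.$$ Here $q(\mathbf e,\phi\mid\cdot)$ is the $(\mathbf e,\phi)$-marginal of the algorithm. -/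

import Mathlib

open MeasureTheory ProbabilityTheory
open scoped ENNReal

noncomputable section

namespace VQVAE

/-- Parameters seen by the encoder side of the model: the codebook `e ∈ 𝒵 ^ K` together with the
encoder parameter `φ ∈ Φ`. -/
abbrev EncParam (K : ℕ) {dz dφ : ℕ} (𝒵 : Set (EuclideanSpace ℝ (Fin dz)))
    (Φ : Set (EuclideanSpace ℝ (Fin dφ))) : Type :=
  (Fin K → 𝒵) × Φ

/-- All parameters `W = (e, φ, θ)` of the model. -/
abbrev Param (K : ℕ) {dz dφ dθ : ℕ} (𝒵 : Set (EuclideanSpace ℝ (Fin dz)))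
    (Φ : Set (EuclideanSpace ℝ (Fin dφ))) (Θ : Set (EuclideanSpace ℝ (Fin dθ))) : Type :=
  EncParam K 𝒵 Φ × Θ

/-- The data space has diameter `sup ‖x - x'‖ < √Δ` with `Δ > 0`
(the extended diameter is used, so boundedness is part of the condition). -/
def DiamLT {d : ℕ} (𝒳 : Set (EuclideanSpace ℝ (Fin d))) (Δ : ℝ) : Prop :=
  0 < Δ ∧ Metric.ediam 𝒳 < ENNReal.ofReal (Real.sqrt Δ)

variable {d dz dφ dθ K n : ℕ}
  {𝒳 : Set (EuclideanSpace ℝ (Fin d))} {𝒵 : Set (EuclideanSpace ℝ (Fin dz))}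
  {Φ : Set (EuclideanSpace ℝ (Fin dφ))} {Θ : Set (EuclideanSpace ℝ (Fin dθ))}

/-- Expected squared reconstruction loss
`l₀(w, x) = 𝔼_{J ∼ q(J | e, φ, x)} ‖x - g_θ(e_J)‖²` for `w = (e, φ, θ)`. -/
def expectedLoss (enc : Kernel (EncParam K 𝒵 Φ × 𝒳) (Fin K)) (g : Θ → 𝒵 → 𝒳)
    (w : Param K 𝒵 Φ Θ) (x : 𝒳) : ℝ :=
  ∫ j, ‖(x : EuclideanSpace ℝ (Fin d)) - (g w.2 (w.1.1 j) : EuclideanSpace ℝ (Fin d))‖ ^ 2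
    ∂(enc (w.1, x))

/-- Generalization error
`|𝔼_{S, X} 𝔼_{W ∼ q(W | S)} [l₀(W, X) - n⁻¹ ∑ₘ l₀(W, Sₘ)]|`, where `S` consists of `n` i.i.d.
samples of `D` and `X ∼ D` is independent of `S` and of `W`. -/
def genError (D : Measure 𝒳) (enc : Kernel (EncParam K 𝒵 Φ × 𝒳) (Fin K)) (g : Θ → 𝒵 → 𝒳)
    (alg : Kernel (Fin n → 𝒳) (Param K 𝒵 Φ Θ)) : ℝ :=
  |∫ s, ∫ x, ∫ w,
      (expectedLoss enc g w x - (1 / (n : ℝ)) * ∑ m : Fin n, expectedLoss enc g w (s m))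
      ∂(alg s) ∂D ∂(Measure.pi fun _ : Fin n => D)|

/-- The test dataset: the first `n` entries of the permuted supersample. -/
def testData (T : Equiv.Perm (Fin (n + n))) (x : Fin (n + n) → 𝒳) : Fin n → 𝒳 :=
  fun m => x (T (Fin.castAdd n m))

/-- The training dataset: the last `n` entries of the permuted supersample. -/
def trainData (T : Equiv.Perm (Fin (n + n))) (x : Fin (n + n) → 𝒳) : Fin n → 𝒳 :=
  fun m => x (T (Fin.natAdd n m))

/-- Joint law `∏ₘ q(Jₘ | e, φ, sₘ)` of the latent indices of a dataset `s`. -/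
def indexLaw (enc : Kernel (EncParam K 𝒵 Φ × 𝒳) (Fin K)) (p : EncParam K 𝒵 Φ)
    (s : Fin n → 𝒳) : Measure (Fin n → Fin K) :=
  Measure.pi fun m => enc (p, s m)

/-- Joint posterior of the latent indices `(J̄, J)` of the test and training data, for a given
supersample `x` and permutation `T`. -/
def jointPosterior (enc : Kernel (EncParam K 𝒵 Φ × 𝒳) (Fin K)) (p : EncParam K 𝒵 Φ)
    (x : Fin (n + n) → 𝒳) (T : Equiv.Perm (Fin (n + n))) :
    Measure ((Fin n → Fin K) × (Fin n → Fin K)) :=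
  (indexLaw enc p (testData T x)).prod (indexLaw enc p (trainData T x))

/-- The permutation symmetric prior: the average of the joint posteriors over all permutations
of the `2n` supersample points. -/
def permPrior (enc : Kernel (EncParam K 𝒵 Φ × 𝒳) (Fin K)) (p : EncParam K 𝒵 Φ)
    (x : Fin (n + n) → 𝒳) : Measure ((Fin n → Fin K) × (Fin n → Fin K)) :=
  ((Nat.factorial (n + n) : ℕ) : ℝ≥0∞)⁻¹ •
    ∑ T : Equiv.Perm (Fin (n + n)), jointPosterior enc p x T

/-- `𝔼_{X̃, T} 𝔼_{(e, φ) ∼ q(e, φ | X̃_{T₁})} KL(Q_{J̃, T} ‖ Q_{J̃})`, with `X̃` consisting of `2n`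
i.i.d. samples of `D`, `T` a uniform permutation independent of `X̃`, and `q(e, φ | ·)` the
`(e, φ)`-marginal of the learning algorithm. -/
def expectedKL (D : Measure 𝒳) (enc : Kernel (EncParam K 𝒵 Φ × 𝒳) (Fin K))
    (alg : Kernel (Fin n → 𝒳) (Param K 𝒵 Φ Θ)) : ℝ≥0∞ :=
  ∫⁻ x, ((Nat.factorial (n + n) : ℕ) : ℝ≥0∞)⁻¹ * ∑ T : Equiv.Perm (Fin (n + n)),
      ∫⁻ p, InformationTheory.klDiv (jointPosterior enc p x T) (permPrior enc p x)
        ∂(alg.fst (trainData T x))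
    ∂(Measure.pi fun _ : Fin (n + n) => D)

end VQVAE

end

/-!
For fixed data and parameters, the Donsker–Varadhan inequality compares the law of the latent
indices with its permutation symmetric mixture. It is applied to a sum of scores that add up to zero
over the `2n` positions, so that under the mixture Hoeffding's lemma, applied while the random
permutation is revealed position by position, bounds the exponential moment by a term of order `n`.
Optimizing the scale gives the square root of the divergence.

The squared losses `‖x - c‖² = ‖x‖² - 2⟪x, c⟫ + ‖c‖²`, counted positively on the test half and
negatively on the training half, do not balance, because the sample means of the two halves differ.
Correcting this costs a term that is linear in the sample means and in the mean reconstruction of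
the training half. Its expectation only involves the training mean, which after centring the data
has variance of order `1 / n`, so that the correction is at most `Δ / √n`.
-/

namespace VQVAE

/-- Tail oscillation of the entries of a random permutation statistic `∑ i, ψ i (y (σ i))`: the
effect at position `i` of replacing the value `j` by `j'` exceeds its average effect over the later
positions by at most `C`. This bounds the increments of the martingale that reveals `σ` position by
position. The average is multiplied out because there are no later positions when `i` is last. -/
def TailOscillationLE {N : ℕ} {κ : Type*} (ψ : Fin N → κ → ℝ) (C : ℝ) : Prop :=
  ∀ i j j', ∑ l ∈ Finset.Ioi i, ((ψ i j - ψ i j') - (ψ l j - ψ l j')) ≤ (Finset.Ioi i).card * C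

/-- Conditional expectation of the statistic `∑ i, ψ i (y (σ i))` of a uniformly random permutation
`σ` of `M + 1` points, given that `σ 0 = k`. -/
noncomputable def revealedMean {M : ℕ} {κ : Type*} (ψ : Fin (M + 1) → κ → ℝ)
    (y : Fin (M + 1) → κ) (k : Fin (M + 1)) : ℝ :=
  ψ 0 (y k) + (∑ i : Fin M, ∑ l, ψ i.succ (y l) - ∑ i : Fin M, ψ i.succ (y k)) / M

section Permutation

variable {κ : Type*} {M : ℕ} {C : ℝ}

lemma TailOscillationLE.comp_succ {ψ : Fin (M + 1) → κ → ℝ} (hψ : TailOscillationLE ψ C) :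
    TailOscillationLE (fun i => ψ i.succ) C := fun i j j' => by
  simpa [← Fin.map_succEmb_Ioi] using hψ i.succ j j'

lemma TailOscillationLE.revealedMean_sub_le {ψ : Fin (M + 1) → κ → ℝ}
    (hψ : TailOscillationLE ψ C) (hC : 0 ≤ C) (y : Fin (M + 1) → κ) (k k' : Fin (M + 1)) :
    revealedMean ψ y k - revealedMean ψ y k' ≤ C := by
  rcases Nat.eq_zero_or_pos M with rfl | hM
  · simpa [Subsingleton.elim (α := Fin 1) k k'] using hC
  have hM' : (0 : ℝ) < M := mod_cast hM
  have h := hψ 0 (y k) (y k')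
  simp only [Fin.Ioi_zero_eq_map, Finset.card_map, Finset.card_univ, Fintype.card_fin,
    Finset.sum_map, Fin.coe_succEmb, Finset.sum_sub_distrib, Finset.sum_const, nsmul_eq_mul] at h
  refine le_of_mul_le_mul_left (le_of_eq_of_le ?_ h) hM'
  simp only [revealedMean]
  field_simp
  ring

lemma sum_revealedMean (ψ : Fin (M + 1) → κ → ℝ) (y : Fin (M + 1) → κ) :
    ∑ k, revealedMean ψ y k = ∑ i, ∑ l, ψ i (y l) := by
  simp only [revealedMean, Finset.sum_add_distrib, ← Finset.sum_div, Finset.sum_sub_distrib,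
    Fin.sum_univ_succ (fun i => ∑ l, ψ i (y l)), add_right_inj]
  rw [Finset.sum_comm (f := fun k (i : Fin M) => ψ i.succ (y k))]
  rcases Nat.eq_zero_or_pos M with rfl | hM
  · simp
  have hM' : (M : ℝ) ≠ 0 := by positivity
  simp only [Finset.sum_const, Finset.card_univ, Fintype.card_fin, nsmul_eq_mul, Nat.cast_add,
    Nat.cast_one]
  field_simp
  ring

lemma sum_comp_swap_succ (φ : Fin (M + 1) → ℝ) (k : Fin (M + 1)) :
    ∑ l : Fin M, φ (Equiv.swap 0 k l.succ) = ∑ l, φ l - φ k := by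
  rw [← Equiv.sum_comp (Equiv.swap 0 k) φ, Fin.sum_univ_succ, Equiv.swap_apply_left,
    add_sub_cancel_left]

lemma sum_perm_eq_sum_swap (F : Equiv.Perm (Fin (M + 1)) → ℝ) :
    ∑ σ, F σ = ∑ k, ∑ τ, F (Equiv.Perm.decomposeFin.symm (k, τ)) := by
  rw [← Equiv.sum_comp Equiv.Perm.decomposeFin.symm, Fintype.sum_prod_type]

lemma sum_exp_le_of_sub_le {ι : Type*} [Fintype ι] [Nonempty ι] (h : ι → ℝ)
    (hC : ∀ k k', h k - h k' ≤ C) :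
    ∑ k, Real.exp (h k) ≤
      Fintype.card ι * Real.exp ((∑ k, h k) / Fintype.card ι + C ^ 2 / 8) := by
  let _ : MeasurableSpace ι := ⊤
  have : MeasurableSingletonClass ι := ⟨fun _ => trivial⟩
  obtain ⟨k₀, hk₀⟩ := Finite.exists_min h
  have hcard : (0 : ℝ) < Fintype.card ι := mod_cast Fintype.card_pos
  let μ : Measure ι := uniformOn Set.univ
  have : IsProbabilityMeasure μ := isProbabilityMeasure_uniformOn Set.finite_univ Set.univ_nonempty
  have hint (f : ι → ℝ) : ∫ k, f k ∂μ = (∑ k, f k) / Fintype.card ι := by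
    simp [integral_fintype Integrable.of_finite, μ, uniformOn_univ, Measure.real, Finset.mul_sum,
      div_eq_inv_mul]
  have hoeffding := (hasSubgaussianMGF_of_mem_Icc (μ := μ) (X := h) (a := h k₀) (b := h k₀ + C)
    (measurable_of_finite h).aemeasurable
    (.of_forall fun k => ⟨hk₀ k, by linarith [hC k k₀]⟩)).mgf_le 1
  rw [mgf, hint, hint] at hoeffding
  set m := (∑ k, h k) / Fintype.card ι
  have hvar : (((‖h k₀ + C - h k₀‖₊ / 2) ^ 2 : NNReal) : ℝ) * 1 ^ 2 / 2 = C ^ 2 / 8 := by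
    rw [add_sub_cancel_left]
    push_cast
    rw [Real.norm_eq_abs, div_pow, sq_abs]
    ring
  rw [hvar, div_le_iff₀ hcard] at hoeffding
  calc ∑ k, Real.exp (h k) = Real.exp m * ∑ k, Real.exp (1 * (h k - m)) := by
        simp only [one_mul, Finset.mul_sum, ← Real.exp_add, add_sub_cancel]
    _ ≤ Real.exp m * (Real.exp (C ^ 2 / 8) * Fintype.card ι) := by gcongr
    _ = _ := by rw [Real.exp_add]; ring

/-- The position `σ 0` is revealed first; given its value, the remaining positions form a random
permutation of the remaining points, and Hoeffding's lemma controls the revealed mean. -/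
theorem TailOscillationLE.sum_perm_exp_le {N : ℕ} {ψ : Fin N → κ → ℝ} (hψ : TailOscillationLE ψ C)
    (hC : 0 ≤ C) (y : Fin N → κ) :
    ∑ σ : Equiv.Perm (Fin N), Real.exp (∑ i, ψ i (y (σ i))) ≤
      N.factorial * Real.exp ((∑ i, ∑ l, ψ i (y l)) / N + N * (C ^ 2 / 8)) := by
  induction N with
  | zero => simp
  | succ M ih =>
    have tail (k : Fin (M + 1)) : ∑ τ : Equiv.Perm (Fin M),
        Real.exp (∑ i : Fin M, ψ i.succ (y (Equiv.swap 0 k (τ i).succ))) ≤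
        M.factorial * Real.exp (M * (C ^ 2 / 8)) *
          Real.exp (revealedMean ψ y k - ψ 0 (y k)) := by
      refine (ih hψ.comp_succ fun l => y (Equiv.swap 0 k l.succ)).trans_eq ?_
      simp only [fun i : Fin M => sum_comp_swap_succ (fun l => ψ i.succ (y l)) k,
        Finset.sum_sub_distrib, revealedMean, add_sub_cancel_left, Real.exp_add]
      ring
    calc ∑ σ : Equiv.Perm (Fin (M + 1)), Real.exp (∑ i, ψ i (y (σ i)))
        = ∑ k, Real.exp (ψ 0 (y k)) * ∑ τ : Equiv.Perm (Fin M),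
            Real.exp (∑ i : Fin M, ψ i.succ (y (Equiv.swap 0 k (τ i).succ))) := by
          simp only [sum_perm_eq_sum_swap, Fin.sum_univ_succ (fun i => ψ i _),
            Equiv.Perm.decomposeFin_symm_apply_zero, Equiv.Perm.decomposeFin_symm_apply_succ,
            Real.exp_add, Finset.mul_sum]
      _ ≤ ∑ k, Real.exp (ψ 0 (y k)) * (M.factorial * Real.exp (M * (C ^ 2 / 8)) *
            Real.exp (revealedMean ψ y k - ψ 0 (y k))) := by gcongr with k; exact tail k
      _ = M.factorial * Real.exp (M * (C ^ 2 / 8)) * ∑ k, Real.exp (revealedMean ψ y k) := by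
          rw [Finset.mul_sum]
          refine Finset.sum_congr rfl fun k _ => ?_
          rw [mul_left_comm, ← Real.exp_add, add_sub_cancel]
      _ ≤ M.factorial * Real.exp (M * (C ^ 2 / 8)) * ((M + 1 : ℕ) *
            Real.exp ((∑ i, ∑ l, ψ i (y l)) / (M + 1 : ℕ) + C ^ 2 / 8)) := by
          gcongr
          simpa only [Fintype.card_fin, sum_revealedMean] using
            sum_exp_le_of_sub_le _ (hψ.revealedMean_sub_le hC y)
      _ = _ := by
          rw [Nat.factorial_succ]
          push_cast
          rw [add_mul (M : ℝ) 1 (C ^ 2 / 8), one_mul]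
          simp only [Real.exp_add]
          ring

end Permutation

section RelativeEntropy

open InformationTheory

variable {Ω : Type*} [MeasurableSpace Ω] {Q P : Measure Ω} [IsProbabilityMeasure Q]
  [IsProbabilityMeasure P]

lemma integral_le_toReal_klDiv_add_log (h : klDiv Q P ≠ ∞) {F : Ω → ℝ} (hFQ : Integrable F Q)
    (hFP : Integrable (fun ω => Real.exp (F ω)) P) :
    ∫ ω, F ω ∂Q ≤ (klDiv Q P).toReal + Real.log (∫ ω, Real.exp (F ω) ∂P) := by
  obtain ⟨hac, hllr⟩ := klDiv_ne_top_iff.1 h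
  have := isProbabilityMeasure_tilted hFP
  have nonneg := integral_llr_add_sub_measure_univ_nonneg
    (hac.trans (absolutelyContinuous_tilted hFP)) (integrable_llr_tilted_right hac hFQ hllr hFP)
  rw [integral_llr_tilted_right hac hFQ hFP hllr] at nonneg
  rw [toReal_klDiv_of_measure_eq hac (by simp)]
  simp only [probReal_univ] at nonneg
  linarith

variable [MeasurableSingletonClass Ω]

lemma klDiv_eq_ofReal_sum [Fintype Ω] (hac : Q ≪ P) :
    klDiv Q P = ENNReal.ofReal (∑ ω, Q.real {ω} * Real.log (Q.real {ω} / P.real {ω})) := by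
  have density (ω : Ω) : Q.real {ω} = (Q.rnDeriv P ω).toReal * P.real {ω} := by
    have := congrArg (fun ν : Measure Ω => ν.real {ω}) (Measure.withDensity_rnDeriv_eq Q P hac)
    simpa [Measure.real, withDensity_apply, Measure.restrict_singleton, mul_comm] using this.symm
  rw [klDiv_of_ac_of_integrable hac .of_finite, integral_fintype .of_finite]
  simp only [probReal_univ, add_sub_cancel_right, smul_eq_mul, llr]
  refine congrArg _ (Finset.sum_congr rfl fun ω _ => ?_)
  rcases eq_or_ne (P.real {ω}) 0 with hP | hP
  · simp [density ω, hP]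
  · rw [density ω, mul_div_cancel_right₀ _ hP]

lemma klDiv_le_ofReal_log_of_le_smul [Finite Ω] {C : NNReal} (h : Q ≤ C • P) :
    klDiv Q P ≤ ENNReal.ofReal (Real.log C) := by
  have := Fintype.ofFinite Ω
  have le_mul (ω : Ω) : Q.real {ω} ≤ C * P.real {ω} :=
    ENNReal.toReal_mono (by finiteness) (h {ω}) |>.trans_eq (by simp [Measure.real])
  rw [klDiv_eq_ofReal_sum (Measure.absolutelyContinuous_of_le_smul h)]
  gcongr
  calc ∑ ω, Q.real {ω} * Real.log (Q.real {ω} / P.real {ω})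
      ≤ ∑ ω, Q.real {ω} * Real.log C := by
        refine Finset.sum_le_sum fun ω _ => ?_
        rcases (measureReal_nonneg (μ := Q) (s := {ω})).eq_or_lt with hQ | hQ
        · simp [← hQ]
        · have hP : 0 < P.real {ω} :=
            pos_of_mul_pos_right (hQ.trans_le (le_mul ω)) C.coe_nonneg
          gcongr
          exact (div_le_iff₀ hP).2 (le_mul ω)
    _ = Real.log C := by
        rw [← Finset.sum_mul, sum_measureReal_singleton, Finset.coe_univ, probReal_univ, one_mul]

end RelativeEntropy

section PermMixture

open InformationTheory

variable {κ : Type*} [MeasurableSpace κ] {N : ℕ}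

/-- The law of independent values with marginals `μ`, averaged over all assignments of the marginals
to the positions: the permutation symmetric prior of the change of measure. -/
noncomputable def permMixture (μ : Fin N → Measure κ) : Measure (Fin N → κ) :=
  (N.factorial : ℝ≥0∞)⁻¹ • ∑ T : Equiv.Perm (Fin N), Measure.pi fun i => μ (T i)

/-- The relative entropy of independent values with marginals `μ` with respect to their permutation
symmetric mixture: the complexity term of the generalization bound. -/
noncomputable def permDiv (μ : Fin N → Measure κ) : ℝ≥0∞ := klDiv (Measure.pi μ) (permMixture μ)

lemma measurePreserving_comp_perm {ι : Type*} [Fintype ι] (μ : ι → Measure κ)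
    [∀ i, SigmaFinite (μ i)] (T : Equiv.Perm ι) :
    MeasurePreserving (fun y : ι → κ => y ∘ T) (Measure.pi μ) (Measure.pi fun i => μ (T i)) :=
  (measurePreserving_piCongrLeft μ T).symm

variable (μ : Fin N → Measure κ)

lemma pi_le_factorial_smul_permMixture :
    Measure.pi μ ≤ (N.factorial : NNReal) • permMixture μ := by
  have h0 : (N.factorial : ℝ≥0∞) ≠ 0 := by exact_mod_cast N.factorial_ne_zero
  change _ ≤ ((N.factorial : NNReal) : ℝ≥0∞) • permMixture μ
  rw [permMixture, smul_smul, ENNReal.coe_natCast,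
    ENNReal.mul_inv_cancel h0 (ENNReal.natCast_ne_top _), one_smul]
  exact Finset.single_le_sum (f := fun T : Equiv.Perm (Fin N) => Measure.pi fun i => μ (T i))
    (fun _ _ => Measure.zero_le _) (Finset.mem_univ 1)

variable [∀ i, IsProbabilityMeasure (μ i)]

instance isProbabilityMeasure_permMixture : IsProbabilityMeasure (permMixture μ) where
  measure_univ := by
    simp [permMixture, Fintype.card_perm, ENNReal.inv_mul_cancel, N.factorial_ne_zero]

variable [Finite κ] [MeasurableSingletonClass κ]

lemma integral_permMixture (F : (Fin N → κ) → ℝ) :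
    ∫ y, F y ∂permMixture μ =
      ∫ y, (N.factorial : ℝ)⁻¹ * ∑ T : Equiv.Perm (Fin N), F (y ∘ T) ∂Measure.pi μ := by
  rw [permMixture, integral_smul_measure, integral_finsetSum_measure fun _ _ => .of_finite,
    integral_const_mul, integral_finsetSum _ fun _ _ => .of_finite]
  simp only [ENNReal.toReal_inv, ENNReal.toReal_natCast, smul_eq_mul]
  congr 1
  refine Finset.sum_congr rfl fun T _ => ?_
  rw [← (measurePreserving_comp_perm μ T).map_eq,
    integral_map (measurePreserving_comp_perm μ T).measurable.aemeasurable
      (measurable_of_finite F).aestronglyMeasurable]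

lemma permDiv_le : permDiv μ ≤ ENNReal.ofReal (Real.log N.factorial) := by
  simpa only [permDiv, NNReal.coe_natCast] using
    klDiv_le_ofReal_log_of_le_smul (pi_le_factorial_smul_permMixture μ)

variable {μ} {ψ : Fin N → κ → ℝ} {C : ℝ}

lemma TailOscillationLE.integral_exp_permMixture_le (hψ : TailOscillationLE ψ C) (hC : 0 ≤ C)
    (balanced : ∀ j, ∑ i, ψ i j = 0) :
    ∫ y, Real.exp (∑ i, ψ i (y i)) ∂permMixture μ ≤ Real.exp (N * (C ^ 2 / 8)) := by
  rw [integral_permMixture]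
  refine (integral_mono .of_finite (integrable_const (Real.exp (N * (C ^ 2 / 8))))
    fun y => ?_).trans_eq (by simp)
  have mean_zero : ∑ i, ∑ l, ψ i (y l) = 0 := by
    rw [Finset.sum_comm]
    simp only [balanced, Finset.sum_const_zero]
  rw [inv_mul_le_iff₀ (by positivity)]
  simpa [mean_zero] using hψ.sum_perm_exp_le hC y

theorem TailOscillationLE.sum_integral_le_permDiv_add (hψ : TailOscillationLE ψ C) (hC : 0 ≤ C)
    (balanced : ∀ j, ∑ i, ψ i j = 0) :
    ∑ i, ∫ j, ψ i j ∂μ i ≤ (permDiv μ).toReal + N * (C ^ 2 / 8) := by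
  calc ∑ i, ∫ j, ψ i j ∂μ i = ∫ y, ∑ i, ψ i (y i) ∂Measure.pi μ := by
        rw [integral_finsetSum _ fun _ _ => .of_finite]
        exact Finset.sum_congr rfl fun i _ =>
          (integral_comp_eval (measurable_of_finite _).aestronglyMeasurable).symm
    _ ≤ (permDiv μ).toReal + Real.log (∫ y, Real.exp (∑ i, ψ i (y i)) ∂permMixture μ) :=
        integral_le_toReal_klDiv_add_log (ne_top_of_le_ne_top (by finiteness) (permDiv_le μ))
          .of_finite .of_finite
    _ ≤ (permDiv μ).toReal + N * (C ^ 2 / 8) := by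
        gcongr
        refine (Real.log_le_log (integral_exp_pos .of_finite)
          (hψ.integral_exp_permMixture_le hC balanced)).trans_eq (Real.log_exp _)

end PermMixture

section Blocks

variable {κ : Type*} {m n : ℕ}

lemma castAdd_lt_natAdd (i : Fin m) (l : Fin n) : Fin.castAdd n i < Fin.natAdd m l :=
  Fin.lt_def.2 (i.2.trans_le (Nat.le_add_right m l))

lemma sum_Ioi_castAdd {M : Type*} [AddCommMonoid M] (F : Fin (m + n) → M) (i : Fin m) :
    ∑ l ∈ Finset.Ioi (Fin.castAdd n i), F l =
      ∑ l ∈ Finset.Ioi i, F (Fin.castAdd n l) + ∑ l, F (Fin.natAdd m l) := by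
  simp [← Finset.filter_lt_eq_Ioi, Finset.sum_filter, Fin.sum_univ_add, castAdd_lt_natAdd,
    (Fin.strictMono_castAdd n).lt_iff_lt]

lemma sum_Ioi_natAdd {M : Type*} [AddCommMonoid M] (F : Fin (m + n) → M) (i : Fin n) :
    ∑ l ∈ Finset.Ioi (Fin.natAdd m i), F l = ∑ l ∈ Finset.Ioi i, F (Fin.natAdd m l) := by
  simp [← Finset.filter_lt_eq_Ioi, Finset.sum_filter, Fin.sum_univ_add,
    (castAdd_lt_natAdd _ _).not_gt]

lemma TailOscillationLE.of_blocks {ψ : Fin (m + n) → κ → ℝ} {C : ℝ}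
    (left : ∀ i l j j', (ψ (Fin.castAdd n i) j - ψ (Fin.castAdd n i) j') -
      (ψ (Fin.castAdd n l) j - ψ (Fin.castAdd n l) j') ≤ C)
    (right : ∀ i l j j', (ψ (Fin.natAdd m i) j - ψ (Fin.natAdd m i) j') -
      (ψ (Fin.natAdd m l) j - ψ (Fin.natAdd m l) j') ≤ C)
    (cross : ∀ i j j', ∑ l, ((ψ (Fin.castAdd n i) j - ψ (Fin.castAdd n i) j') -
      (ψ (Fin.natAdd m l) j - ψ (Fin.natAdd m l) j')) ≤ n * C) :
    TailOscillationLE ψ C := by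
  intro i j j'
  rw [← nsmul_eq_mul, ← Finset.sum_const]
  induction i using Fin.addCases with
  | left i =>
    rw [sum_Ioi_castAdd, sum_Ioi_castAdd]
    refine add_le_add (Finset.sum_le_sum fun l _ => left i l j j') ?_
    simpa using cross i j j'
  | right i =>
    rw [sum_Ioi_natAdd, sum_Ioi_natAdd]
    exact Finset.sum_le_sum fun l _ => right i l j j'

lemma TailOscillationLE.const_mul {N : ℕ} {ψ : Fin N → κ → ℝ} {C : ℝ}
    (hψ : TailOscillationLE ψ C) (s : ℝ) :
    TailOscillationLE (fun i j => s * ψ i j) (|s| * C) := fun i j j' => by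
  simp only [← mul_sub, ← Finset.mul_sum]
  rw [mul_left_comm]
  rcases le_total 0 s with hs | hs
  · rw [abs_of_nonneg hs]
    exact mul_le_mul_of_nonneg_left (hψ i j j') hs
  · have swap : ∑ l ∈ Finset.Ioi i, ((ψ i j - ψ i j') - (ψ l j - ψ l j')) =
        -∑ l ∈ Finset.Ioi i, ((ψ i j' - ψ i j) - (ψ l j' - ψ l j)) := by
      rw [← Finset.sum_neg_distrib]
      exact Finset.sum_congr rfl fun l _ => by ring
    rw [abs_of_nonpos hs, swap, mul_neg, ← neg_mul]
    exact mul_le_mul_of_nonneg_left (hψ i j' j) (neg_nonneg.2 hs)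

end Blocks

section SampleMean

/-- The mean `n⁻¹ ∑ₘ vₘ` of a sample of vectors. -/
noncomputable def sampleMean {E : Type*} [AddCommGroup E] [Module ℝ E] {n : ℕ} (v : Fin n → E) :
    E :=
  (n : ℝ)⁻¹ • ∑ m, v m

lemma natCast_smul_sampleMean {E : Type*} [AddCommGroup E] [Module ℝ E] {n : ℕ} (v : Fin n → E) :
    (n : ℝ) • sampleMean v = ∑ m, v m := by
  rcases Nat.eq_zero_or_pos n with rfl | hn
  · simp
  · exact smul_inv_smul₀ (by positivity) _

lemma natCast_mul_sampleMean {n : ℕ} (v : Fin n → ℝ) : (n : ℝ) * sampleMean v = ∑ m, v m :=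
  natCast_smul_sampleMean v

lemma natCast_mul_inner_sampleMean {E : Type*} [NormedAddCommGroup E] [InnerProductSpace ℝ E]
    {n : ℕ} (v : Fin n → E) (u : E) :
    (n : ℝ) * inner ℝ (sampleMean v) u = ∑ m, inner ℝ (v m) u := by
  rw [← real_inner_smul_left, natCast_smul_sampleMean, sum_inner]

end SampleMean

section Score

variable {E κ : Type*} [NormedAddCommGroup E] [InnerProductSpace ℝ E] {n : ℕ}

/-- Index scores of the `2n` positions, for test data `a`, training data `b` and centers `c`: the
squared distance to the selected center, up to a constant, counted positively on the test block and
negatively on the training block. The inner product with the difference of the sample means balances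
the scores: those of a fixed index sum to zero over the positions. -/
noncomputable def score (a b : Fin n → E) (c : κ → E) : Fin (n + n) → κ → ℝ :=
  Fin.append (fun m j => ‖a m - c j‖ ^ 2 - ‖a m‖ ^ 2)
    fun m j => ‖b m‖ ^ 2 - ‖b m - c j‖ ^ 2 + 2 * inner ℝ (sampleMean a - sampleMean b) (c j)

/-- What remains of the difference between the mean squared distances of test data `a` and training
data `b` to their selected centers once the balanced scores are removed. The selected centers enter
through their mean `k` over the training data only. -/
noncomputable def surrogateGap (a b : Fin n → E) (k : E) : ℝ :=
  sampleMean (fun m => ‖a m‖ ^ 2) - sampleMean (fun m => ‖b m‖ ^ 2) -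
    2 * inner ℝ (sampleMean a - sampleMean b) k

variable (a b : Fin n → E) (c : κ → E)

lemma score_castAdd (m : Fin n) (j : κ) :
    score a b c (Fin.castAdd n m) j = ‖a m - c j‖ ^ 2 - ‖a m‖ ^ 2 := by
  simp [score]

lemma score_natAdd (m : Fin n) (j : κ) :
    score a b c (Fin.natAdd n m) j =
      ‖b m‖ ^ 2 - ‖b m - c j‖ ^ 2 + 2 * inner ℝ (sampleMean a - sampleMean b) (c j) := by
  rw [score, Fin.append_right]

lemma sum_score_natAdd (j : κ) :
    ∑ m, score a b c (Fin.natAdd n m) j = -∑ m, score a b c (Fin.castAdd n m) j := by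
  simp only [score_natAdd, score_castAdd, norm_sub_sq_real, Finset.sum_add_distrib,
    Finset.sum_sub_distrib, inner_sub_left, mul_sub, ← Finset.mul_sum, Finset.sum_const,
    Finset.card_univ, Fintype.card_fin, nsmul_eq_mul, ← natCast_mul_inner_sampleMean]
  ring

lemma sum_score (j : κ) : ∑ i, score a b c i j = 0 := by
  rw [Fin.sum_univ_add, sum_score_natAdd, add_neg_cancel]

lemma inner_sub_sub_le {Δ : ℝ} {u v w z : E} (huv : ‖u - v‖ ^ 2 ≤ Δ) (hwz : ‖w - z‖ ^ 2 ≤ Δ) :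
    inner ℝ (u - v) (w - z) ≤ Δ := by
  have := real_inner_le_norm (u - v) (w - z)
  nlinarith [sq_nonneg (‖u - v‖ - ‖w - z‖)]

variable {a b c} {Δ : ℝ}

theorem tailOscillationLE_score (haa : ∀ m m', ‖a m - a m'‖ ^ 2 ≤ Δ)
    (hbb : ∀ m m', ‖b m - b m'‖ ^ 2 ≤ Δ) (hcc : ∀ j j', ‖c j - c j'‖ ^ 2 ≤ Δ)
    (hac : ∀ m j, ‖a m - c j‖ ^ 2 ≤ Δ) : TailOscillationLE (score a b c) (2 * Δ) := by
  refine .of_blocks (fun m l j j' => ?_) (fun m l j j' => ?_) fun m j j' => ?_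
  · have := inner_sub_sub_le (haa m l) (hcc j' j)
    simp only [inner_sub_left, inner_sub_right] at this
    simp only [score_castAdd, norm_sub_sq_real]
    linarith
  · have := inner_sub_sub_le (hbb m l) (hcc j j')
    simp only [inner_sub_left, inner_sub_right] at this
    simp only [score_natAdd, norm_sub_sq_real]
    linarith
  · have le_test (l : Fin n) :
        score a b c (Fin.castAdd n l) j - score a b c (Fin.castAdd n l) j' ≤ Δ := by
      simp only [score_castAdd]
      linarith [hac l j, sq_nonneg ‖a l - c j'‖]
    simp only [Finset.sum_sub_distrib, sum_score_natAdd, sub_neg_eq_add]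
    calc _ = ∑ l : Fin n,
          ((score a b c (Fin.castAdd n m) j - score a b c (Fin.castAdd n m) j') +
            (score a b c (Fin.castAdd n l) j - score a b c (Fin.castAdd n l) j')) := by
          simp only [Finset.sum_add_distrib, Finset.sum_sub_distrib]
          ring
      _ ≤ ∑ _ : Fin n, 2 * Δ := by
          gcongr with l
          linarith [le_test m, le_test l]
      _ = n * (2 * Δ) := by simp

variable [CompleteSpace E] [Finite κ] [MeasurableSpace κ] [MeasurableSingletonClass κ]
  (q : Fin (n + n) → Measure κ) [∀ i, IsProbabilityMeasure (q i)]

lemma sum_integral_score :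
    ∑ i, ∫ j, score a b c i j ∂q i =
      n * (sampleMean (fun m => ∫ j, ‖a m - c j‖ ^ 2 ∂q (Fin.castAdd n m)) -
        sampleMean (fun m => ∫ j, ‖b m - c j‖ ^ 2 ∂q (Fin.natAdd n m)) -
        surrogateGap a b (sampleMean fun m => ∫ j, c j ∂q (Fin.natAdd n m))) := by
  have test (m : Fin n) : ∫ j, score a b c (Fin.castAdd n m) j ∂q (Fin.castAdd n m) =
      ∫ j, ‖a m - c j‖ ^ 2 ∂q (Fin.castAdd n m) - ‖a m‖ ^ 2 := by
    simp only [score_castAdd]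
    rw [integral_sub .of_finite .of_finite]
    simp
  have train (m : Fin n) : ∫ j, score a b c (Fin.natAdd n m) j ∂q (Fin.natAdd n m) =
      ‖b m‖ ^ 2 - ∫ j, ‖b m - c j‖ ^ 2 ∂q (Fin.natAdd n m) +
        2 * inner ℝ (sampleMean a - sampleMean b) (∫ j, c j ∂q (Fin.natAdd n m)) := by
    simp only [score_natAdd]
    rw [integral_add .of_finite .of_finite, integral_sub .of_finite .of_finite,
      integral_const_mul, integral_inner .of_finite]
    simp
  have center : (n : ℝ) * inner ℝ (sampleMean a - sampleMean b)
      (sampleMean fun m => ∫ j, c j ∂q (Fin.natAdd n m)) =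
      ∑ m, inner ℝ (sampleMean a - sampleMean b) (∫ j, c j ∂q (Fin.natAdd n m)) := by
    simp only [real_inner_comm _ (sampleMean a - sampleMean b), natCast_mul_inner_sampleMean]
  simp only [Fin.sum_univ_add, test, train, surrogateGap, mul_sub, mul_left_comm _ (2 : ℝ), center,
    natCast_mul_sampleMean, Finset.sum_add_distrib, Finset.sum_sub_distrib, Finset.mul_sum]
  ring

/-- The parameter `s` is free because the inequality is only optimized after averaging over the
data. -/
theorem mul_lossGap_sub_surrogateGap_le (haa : ∀ m m', ‖a m - a m'‖ ^ 2 ≤ Δ)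
    (hbb : ∀ m m', ‖b m - b m'‖ ^ 2 ≤ Δ) (hcc : ∀ j j', ‖c j - c j'‖ ^ 2 ≤ Δ)
    (hac : ∀ m j, ‖a m - c j‖ ^ 2 ≤ Δ) (hΔ : 0 ≤ Δ) (s : ℝ) :
    s * (n * (sampleMean (fun m => ∫ j, ‖a m - c j‖ ^ 2 ∂q (Fin.castAdd n m)) -
        sampleMean (fun m => ∫ j, ‖b m - c j‖ ^ 2 ∂q (Fin.natAdd n m)) -
        surrogateGap a b (sampleMean fun m => ∫ j, c j ∂q (Fin.natAdd n m)))) ≤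
      (permDiv q).toReal + n * Δ ^ 2 * s ^ 2 := by
  have key := ((tailOscillationLE_score haa hbb hcc hac).const_mul s).sum_integral_le_permDiv_add
    (μ := q) (by positivity) fun j => by rw [← Finset.mul_sum, sum_score, mul_zero]
  simp only [integral_const_mul, ← Finset.mul_sum] at key
  rw [sum_integral_score] at key
  refine key.trans_eq ?_
  rw [mul_pow, sq_abs]
  push_cast
  ring

end Score

section SampleMeanMoments

variable {α E : Type*} [MeasurableSpace α] [NormedAddCommGroup E] {n : ℕ} {D : Measure α}
  [IsProbabilityMeasure D] {f : α → E}

lemma memLp_comp_eval {p : ℝ≥0∞} (hf : MemLp f p D) (m : Fin n) :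
    MemLp (fun s : Fin n → α => f (s m)) p (Measure.pi fun _ => D) :=
  hf.comp_measurePreserving (measurePreserving_eval (fun _ : Fin n => D) m)

lemma memLp_sampleMean [NormedSpace ℝ E] {p : ℝ≥0∞} (hf : MemLp f p D) :
    MemLp (fun s : Fin n → α => sampleMean fun m => f (s m)) p (Measure.pi fun _ => D) :=
  (memLp_finsetSum _ fun m _ => memLp_comp_eval hf m).const_smul _

lemma integral_sampleMean [NormedSpace ℝ E] [CompleteSpace E] (hn : n ≠ 0) (hf : Integrable f D) :
    ∫ s, sampleMean (fun m => f (s m)) ∂(Measure.pi fun _ : Fin n => D) = ∫ x, f x ∂D := by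
  have (m : Fin n) : ∫ s, f (s m) ∂(Measure.pi fun _ : Fin n => D) = ∫ x, f x ∂D :=
    integral_comp_eval (μ := fun _ : Fin n => D) hf.1
  simp only [sampleMean]
  rw [integral_smul, integral_finsetSum _ fun m _ => integrable_comp_eval hf]
  simp [this, ← Nat.cast_smul_eq_nsmul ℝ, smul_smul, hn]

variable [InnerProductSpace ℝ E]

lemma integrable_inner_of_memLp_two {μ : Measure α} {f g : α → E} (hf : MemLp f 2 μ)
    (hg : MemLp g 2 μ) : Integrable (fun x => (inner ℝ (f x) (g x) : ℝ)) μ :=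
  (hf.norm.integrable_mul hg.norm).mono' (hf.1.inner hg.1)
    (.of_forall fun x => norm_inner_le_norm (f x) (g x))

variable [CompleteSpace E]

lemma integral_inner_eval_eval (hf : Integrable f D) (centered : ∫ x, f x ∂D = 0) {m l : Fin n}
    (hml : m ≠ l) :
    ∫ s, inner ℝ (f (s m)) (f (s l)) ∂(Measure.pi fun _ : Fin n => D) = 0 := by
  have eval (i : Fin n) := measurePreserving_eval (fun _ : Fin n => D) i
  have indep : IndepFun (fun s : Fin n → α => s m) (fun s => s l) (Measure.pi fun _ => D) :=
    (iIndepFun_pi (μ := fun _ : Fin n => D) (X := fun _ x => x)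
      fun _ => aemeasurable_id).indepFun hml
  have product := indep.integral_bilin_comp_comp (eval m).measurable.aemeasurable
    (eval l).measurable.aemeasurable (by rwa [(eval m).map_eq]) (by rwa [(eval l).map_eq])
    (innerSL ℝ (E := E))
  rw [integral_comp_eval (μ := fun _ : Fin n => D) hf.1, centered] at product
  exact product.trans (by simp)

lemma integral_norm_sampleMean_sq (hf : MemLp f 2 D) (centered : ∫ x, f x ∂D = 0) :
    ∫ s, ‖sampleMean fun m => f (s m)‖ ^ 2 ∂(Measure.pi fun _ : Fin n => D) =
      (∫ x, ‖f x‖ ^ 2 ∂D) / n := by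
  have expand (s : Fin n → α) : ‖sampleMean fun m => f (s m)‖ ^ 2 =
      ((n : ℝ)⁻¹) ^ 2 * ∑ m, ∑ l, inner ℝ (f (s m)) (f (s l)) := by
    rw [sampleMean, norm_smul, mul_pow, Real.norm_eq_abs, sq_abs, ← real_inner_self_eq_norm_sq]
    simp only [sum_inner, inner_sum, real_inner_comm]
  have integrable (m l : Fin n) :
      Integrable (fun s : Fin n → α => (inner ℝ (f (s m)) (f (s l)) : ℝ)) (.pi fun _ => D) :=
    integrable_inner_of_memLp_two (memLp_comp_eval hf m) (memLp_comp_eval hf l)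
  have diagonal (m : Fin n) : ∑ l, ∫ s, inner ℝ (f (s m)) (f (s l)) ∂(.pi fun _ : Fin n => D) =
      ∫ x, ‖f x‖ ^ 2 ∂D := by
    rw [Finset.sum_eq_single_of_mem m (Finset.mem_univ m) fun l _ hl =>
      integral_inner_eval_eval (hf.integrable one_le_two) centered hl.symm]
    simp only [real_inner_self_eq_norm_sq]
    exact integral_comp_eval (μ := fun _ : Fin n => D) (f := fun x => ‖f x‖ ^ 2)
      (hf.1.norm.pow 2)
  simp only [expand]
  rw [integral_const_mul, integral_finsetSum _ fun m _ => integrable_finsetSum _ fun l _ =>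
    integrable m l]
  simp only [integral_finsetSum _ fun l _ => integrable _ l, diagonal]
  rcases Nat.eq_zero_or_pos n with rfl | hn
  · simp
  · simp
    field_simp

end SampleMeanMoments

section SurrogateGap

variable {α W E : Type*} [MeasurableSpace α] [MeasurableSpace W] [NormedAddCommGroup E]
  [InnerProductSpace ℝ E] {n : ℕ} {D : Measure α} [IsProbabilityMeasure D]
  {ν : Measure ((Fin n → α) × W)} {f : α → E} {C : (Fin n → α) × W → E}

lemma surrogateGap_eq (a b : Fin n → E) (k : E) :
    surrogateGap a b k = sampleMean (fun m => ‖a m‖ ^ 2) - sampleMean (fun m => ‖b m‖ ^ 2) -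
      2 * inner ℝ (sampleMean a) k + 2 * inner ℝ (sampleMean b) k := by
  rw [surrogateGap, inner_sub_left]
  ring

lemma two_mul_abs_inner_le {r : ℝ} (hr : 0 < r) (u v : E) :
    2 * |inner ℝ u v| ≤ r * ‖u‖ ^ 2 + ‖v‖ ^ 2 / r := by
  have young : r * ‖u‖ ^ 2 + ‖v‖ ^ 2 / r - 2 * (‖u‖ * ‖v‖) = (r * ‖u‖ - ‖v‖) ^ 2 / r := by
    field_simp
    ring
  have : 0 ≤ (r * ‖u‖ - ‖v‖) ^ 2 / r := by positivity
  linarith [abs_real_inner_le_norm u v]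

lemma integral_comp_measurePreserving {β Ω : Type*} [MeasurableSpace β] [MeasurableSpace Ω]
    {μ : Measure Ω} {ρ : Measure β} {S : Ω → β} (hS : MeasurePreserving S μ ρ) {g : β → ℝ}
    (hg : AEStronglyMeasurable g ρ) : ∫ x, g (S x) ∂μ = ∫ y, g y ∂ρ := by
  rw [← hS.map_eq] at hg ⊢
  exact (integral_map hS.aemeasurable hg).symm

lemma integrable_surrogateGap [IsProbabilityMeasure ν]
    (hν : MeasurePreserving Prod.fst ν (Measure.pi fun _ : Fin n => D))
    (hf : MemLp f 2 D) (hC : MemLp C 2 ν) :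
    Integrable (fun z => surrogateGap (fun m => f (z.1 m)) (fun m => f (z.2.1 m)) (C z.2))
      ((Measure.pi fun _ => D).prod ν) := by
  have mean_sq := (memLp_sampleMean (n := n)
    (memLp_one_iff_integrable.2 (hf.integrable_norm_pow two_ne_zero))).integrable le_rfl
  have mean := memLp_sampleMean (n := n) hf
  have test_term := integrable_inner_of_memLp_two (mean.comp_fst ν)
    (hC.comp_snd (Measure.pi fun _ : Fin n => D))
  have train_term := integrable_inner_of_memLp_two (mean.comp_measurePreserving hν) hC
  simp only [surrogateGap_eq]
  exact (((mean_sq.comp_fst ν).sub ((hν.integrable_comp_of_integrable mean_sq).comp_snd _)).sub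
    (test_term.const_mul 2)).add ((train_term.comp_snd _).const_mul 2)

lemma integral_surrogateGap [CompleteSpace E] [IsProbabilityMeasure ν] (hn : n ≠ 0)
    (hν : MeasurePreserving Prod.fst ν (Measure.pi fun _ : Fin n => D))
    (hf : MemLp f 2 D) (centered : ∫ x, f x ∂D = 0) (hC : MemLp C 2 ν) :
    ∫ z, surrogateGap (fun m => f (z.1 m)) (fun m => f (z.2.1 m)) (C z.2)
        ∂((Measure.pi fun _ => D).prod ν) =
      2 * ∫ z, inner ℝ (sampleMean fun m => f (z.1 m)) (C z) ∂ν := by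
  set P : Measure (Fin n → α) := .pi fun _ => D
  have sq_int := hf.integrable_norm_pow two_ne_zero
  have mean_sq := (memLp_sampleMean (n := n) (memLp_one_iff_integrable.2 sq_int)).integrable le_rfl
  have mean := memLp_sampleMean (n := n) hf
  have test_sq := mean_sq.comp_fst ν
  have train_sq : Integrable (fun z => sampleMean fun m => ‖f (z.2.1 m)‖ ^ 2) (P.prod ν) :=
    (hν.integrable_comp_of_integrable mean_sq).comp_snd P
  have test_inner := integrable_inner_of_memLp_two (mean.comp_fst ν) (hC.comp_snd P)
  have train_inner :
      Integrable (fun z => inner ℝ (sampleMean fun m => f (z.2.1 m)) (C z.2)) (P.prod ν) :=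
    (integrable_inner_of_memLp_two (mean.comp_measurePreserving hν) hC).comp_snd P
  have independent : ∫ z, inner ℝ (sampleMean fun m => f (z.1 m)) (C z.2) ∂(P.prod ν) = 0 := by
    refine (integral_prod_bilin (innerSL ℝ) (mean.integrable one_le_two)
      (hC.integrable one_le_two)).trans ?_
    simp [integral_sampleMean hn (hf.integrable one_le_two), centered]
  have second_moments : ∫ z, sampleMean (fun m => ‖f (z.2.1 m)‖ ^ 2) ∂(P.prod ν) =
      ∫ z, sampleMean (fun m => ‖f (z.1 m)‖ ^ 2) ∂(P.prod ν) :=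
    (integral_comp_measurePreserving (hν.comp measurePreserving_snd) mean_sq.1).trans
      (integral_comp_measurePreserving measurePreserving_fst mean_sq.1).symm
  simp only [surrogateGap_eq]
  rw [integral_add (by fun_prop) (by fun_prop), integral_sub (by fun_prop) (by fun_prop),
    integral_sub (by fun_prop) (by fun_prop), second_moments, integral_const_mul, independent,
    integral_const_mul, sub_self, mul_zero, sub_zero, zero_add]
  congr 1
  exact integral_comp_measurePreserving measurePreserving_snd
    (integrable_inner_of_memLp_two (mean.comp_measurePreserving hν) hC).1

theorem abs_integral_surrogateGap_le [CompleteSpace E] [IsProbabilityMeasure ν] (hn : n ≠ 0)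
    (hν : MeasurePreserving Prod.fst ν (Measure.pi fun _ : Fin n => D))
    (hf : MemLp f 2 D) (centered : ∫ x, f x ∂D = 0) (hC : MemLp C 2 ν) :
    |∫ z, surrogateGap (fun m => f (z.1 m)) (fun m => f (z.2.1 m)) (C z.2)
        ∂((Measure.pi fun _ => D).prod ν)| ≤
      (∫ x, ‖f x‖ ^ 2 ∂D + ∫ z, ‖C z‖ ^ 2 ∂ν) / √n := by
  have hn' : 0 < √(n : ℝ) := by positivity
  have mean := memLp_sampleMean (n := n) hf
  have mean_sq : ∫ z, ‖sampleMean fun m => f (z.1 m)‖ ^ 2 ∂ν = (∫ x, ‖f x‖ ^ 2 ∂D) / n :=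
    (integral_comp_measurePreserving hν (mean.1.norm.pow 2)).trans
      (integral_norm_sampleMean_sq hf centered)
  have train_mean : MemLp (fun z => sampleMean fun m => f (z.1 m)) 2 ν :=
    mean.comp_measurePreserving hν
  have mean_int := train_mean.integrable_norm_pow two_ne_zero
  have C_int := hC.integrable_norm_pow two_ne_zero
  rw [integral_surrogateGap hn hν hf centered hC, abs_mul, abs_two]
  calc 2 * |∫ z, inner ℝ (sampleMean fun m => f (z.1 m)) (C z) ∂ν|
      ≤ 2 * ∫ z, |inner ℝ (sampleMean fun m => f (z.1 m)) (C z)| ∂ν := by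
        gcongr
        exact abs_integral_le_integral_abs
    _ = ∫ z, 2 * |inner ℝ (sampleMean fun m => f (z.1 m)) (C z)| ∂ν :=
        (integral_const_mul _ _).symm
    _ ≤ ∫ z, (√n * ‖sampleMean fun m => f (z.1 m)‖ ^ 2 + ‖C z‖ ^ 2 / √n) ∂ν :=
        integral_mono ((integrable_inner_of_memLp_two train_mean hC).abs.const_mul 2)
          ((mean_int.const_mul _).add (C_int.div_const _)) fun z => two_mul_abs_inner_le hn' _ _
    _ = (∫ x, ‖f x‖ ^ 2 ∂D + ∫ z, ‖C z‖ ^ 2 ∂ν) / √n := by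
        rw [integral_add (mean_int.const_mul _) (C_int.div_const _), integral_const_mul,
          integral_div, mean_sq, add_div]
        nth_rewrite 2 [← Real.sq_sqrt n.cast_nonneg]
        field_simp

end SurrogateGap

section Append

variable {m n : ℕ}

lemma append_preimage_univ_pi {β : Type*} (s : Fin (m + n) → Set β) :
    (fun z : (Fin m → β) × (Fin n → β) => Fin.append z.1 z.2) ⁻¹' Set.univ.pi s =
      (Set.univ.pi fun i => s (Fin.castAdd n i)) ×ˢ Set.univ.pi fun i => s (Fin.natAdd m i) := by
  ext z
  simp [Fin.forall_fin_add]

variable {β : Type*} [MeasurableSpace β]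

lemma measurable_append :
    Measurable fun z : (Fin m → β) × (Fin n → β) => Fin.append z.1 z.2 := by
  refine measurable_pi_iff.2 fun i => ?_
  induction i using Fin.addCases with
  | left m => simp only [Fin.append_left]; fun_prop
  | right m => simp only [Fin.append_right]; fun_prop

lemma measurePreserving_append (μ : Fin (m + n) → Measure β) [∀ i, IsProbabilityMeasure (μ i)] :
    MeasurePreserving (fun z : (Fin m → β) × (Fin n → β) => Fin.append z.1 z.2)
      ((Measure.pi fun i => μ (Fin.castAdd n i)).prod (Measure.pi fun i => μ (Fin.natAdd m i)))
      (Measure.pi μ) := by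
  refine ⟨measurable_append, (Measure.pi_eq fun s hs => ?_).symm⟩
  rw [Measure.map_apply measurable_append (.univ_pi hs), append_preimage_univ_pi,
    Measure.prod_prod, Measure.pi_pi, Measure.pi_pi, Fin.prod_univ_add]

end Append

section PermDiv

open InformationTheory

lemma klDiv_map_of_leftInverse {Ω Ω' : Type*} [MeasurableSpace Ω] [MeasurableSpace Ω']
    {Q P : Measure Ω} [IsFiniteMeasure Q] [IsFiniteMeasure P] {g : Ω → Ω'} {h : Ω' → Ω}
    (hg : Measurable g) (hh : Measurable h) (hgh : Function.LeftInverse h g) :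
    klDiv (Q.map g) (P.map g) = klDiv Q P := by
  refine le_antisymm (klDiv_map_le Q P hg) ?_
  simpa only [Measure.map_map hh hg, hgh.comp_eq_id, Measure.map_id] using
    klDiv_map_le (Q.map g) (P.map g) hh

variable {κ : Type*} [MeasurableSpace κ]

lemma permMixture_comp_perm {N : ℕ} (μ : Fin N → Measure κ) (T : Equiv.Perm (Fin N)) :
    permMixture (fun i => μ (T i)) = permMixture μ :=
  congrArg ((N.factorial : ℝ≥0∞)⁻¹ • ·)
    (Equiv.sum_comp (Equiv.mulLeft T) fun T' => Measure.pi fun i => μ (T' i))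

variable [Finite κ] [MeasurableSingletonClass κ]

lemma measurable_permDiv {Ω : Type*} [MeasurableSpace Ω] {N : ℕ} (q : Fin N → Kernel Ω κ)
    [∀ i, IsMarkovKernel (q i)] : Measurable fun ω => permDiv fun i => q i ω := by
  have := Fintype.ofFinite κ
  have mass (i : Fin N) (j : κ) : Measurable fun ω => q i ω {j} :=
    (q i).measurable_coe (.singleton j)
  have pi_mass (ω : Ω) (y : Fin N → κ) :
      (Measure.pi fun i => q i ω).real {y} = ∏ i, (q i ω {y i}).toReal := by
    rw [Measure.real, Measure.pi_singleton, ENNReal.toReal_prod]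
  have mixture_mass (ω : Ω) (y : Fin N → κ) : (permMixture fun i => q i ω).real {y} =
      ((N.factorial : ℝ≥0∞)⁻¹ * ∑ T : Equiv.Perm (Fin N), ∏ i, q (T i) ω {y i}).toReal := by
    simp only [permMixture, Measure.real, Measure.smul_apply, Measure.coe_finsetSum,
      Finset.sum_apply, Measure.pi_singleton, smul_eq_mul]
  simp only [permDiv, klDiv_eq_ofReal_sum (Measure.absolutelyContinuous_of_le_smul
    (pi_le_factorial_smul_permMixture _)), pi_mass, mixture_mass]
  fun_prop

end PermDiv

lemma lintegral_average_perm {α : Type*} [MeasurableSpace α] (D : Measure α) [SigmaFinite D]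
    {N : ℕ} {F : (Fin N → α) → ℝ≥0∞} (hF : Measurable F) :
    ∫⁻ x, (N.factorial : ℝ≥0∞)⁻¹ * ∑ T : Equiv.Perm (Fin N), F (x ∘ T) ∂(.pi fun _ => D) =
      ∫⁻ x, F x ∂(.pi fun _ => D) := by
  have invariant (T : Equiv.Perm (Fin N)) :
      MeasurePreserving (fun x : Fin N → α => x ∘ T) (.pi fun _ => D) (.pi fun _ => D) :=
    measurePreserving_comp_perm (fun _ => D) T
  have measurable (T : Equiv.Perm (Fin N)) : Measurable fun x : Fin N → α => F (x ∘ T) :=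
    hF.comp (invariant T).measurable
  rw [lintegral_const_mul _ (Finset.measurable_fun_sum _ fun T _ => measurable T),
    lintegral_finsetSum _ fun T _ => measurable T]
  simp [fun T => (invariant T).lintegral_comp hF, Fintype.card_perm, ← mul_assoc,
    ENNReal.inv_mul_cancel, N.factorial_ne_zero]

section GeneralizationError

variable {α W : Type*} [MeasurableSpace α] [MeasurableSpace W] {n : ℕ}

/-- The joint law of a test sample, a training sample and the parameters learned from the latter. -/
noncomputable def trainTestLaw (D : Measure α) (alg : Kernel (Fin n → α) W) :
    Measure ((Fin n → α) × ((Fin n → α) × W)) :=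
  (Measure.pi fun _ => D).prod ((Measure.pi fun _ => D) ⊗ₘ alg)

/-- The absolute difference between the expected loss on a fresh data point and on the training
sample. -/
noncomputable def generalizationError (D : Measure α) (ℓ : W → α → ℝ)
    (alg : Kernel (Fin n → α) W) : ℝ :=
  |∫ s, ∫ x, ∫ w, (ℓ w x - (1 / (n : ℝ)) * ∑ m, ℓ w (s m)) ∂alg s ∂D ∂Measure.pi fun _ => D|

instance (D : Measure α) [IsProbabilityMeasure D] (alg : Kernel (Fin n → α) W)
    [IsMarkovKernel alg] : IsProbabilityMeasure (trainTestLaw D alg) := by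
  unfold trainTestLaw
  infer_instance

lemma norm_sampleMean_le {E : Type*} [NormedAddCommGroup E] [NormedSpace ℝ E] {v : Fin n → E}
    {B : ℝ} (hB : 0 ≤ B) (hv : ∀ m, ‖v m‖ ≤ B) : ‖sampleMean v‖ ≤ B := by
  rw [sampleMean, norm_smul, Real.norm_of_nonneg (by positivity)]
  refine inv_mul_le_of_le_mul₀ n.cast_nonneg hB ((norm_sum_le _ _).trans ?_)
  simpa using Finset.sum_le_sum fun m (_ : m ∈ Finset.univ) => hv m

variable {D : Measure α} [IsProbabilityMeasure D] {ℓ : W → α → ℝ} {B : ℝ}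
  {alg : Kernel (Fin n → α) W} [IsMarkovKernel alg]

lemma measurable_sampleMean_loss (hℓ : Measurable ℓ.uncurry) :
    Measurable fun z : W × (Fin n → α) => sampleMean fun m => ℓ z.1 (z.2 m) := by
  have (m : Fin n) : Measurable fun z : W × (Fin n → α) => ℓ z.1 (z.2 m) :=
    hℓ.comp (f := fun z : W × (Fin n → α) => (z.1, z.2 m)) (by fun_prop)
  unfold sampleMean
  fun_prop

lemma integrable_sampleMean_loss_sub (hℓ : Measurable ℓ.uncurry) (hB : 0 ≤ B)
    (bound : ∀ w x, ‖ℓ w x‖ ≤ B) :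
    Integrable (fun z => sampleMean (fun m => ℓ z.2.2 (z.1 m)) -
      sampleMean fun m => ℓ z.2.2 (z.2.1 m)) (trainTestLaw D alg) := by
  have mean := measurable_sampleMean_loss (n := n) hℓ
  have test : Measurable fun z : (Fin n → α) × ((Fin n → α) × W) =>
      sampleMean fun m => ℓ z.2.2 (z.1 m) := mean.comp (measurable_snd.snd.prodMk measurable_fst)
  have train : Measurable fun z : (Fin n → α) × ((Fin n → α) × W) =>
      sampleMean fun m => ℓ z.2.2 (z.2.1 m) :=
    mean.comp (measurable_snd.snd.prodMk measurable_snd.fst)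
  exact .of_bound (test.sub train).aestronglyMeasurable (B + B) (.of_forall fun z =>
    (norm_sub_le _ _).trans (add_le_add (norm_sampleMean_le hB fun m => bound _ _)
      (norm_sampleMean_le hB fun m => bound _ _)))

lemma generalizationError_eq (hn : n ≠ 0) (hℓ : Measurable ℓ.uncurry) (hB : 0 ≤ B)
    (bound : ∀ w x, ‖ℓ w x‖ ≤ B) :
    generalizationError D ℓ alg =
      |∫ z, (sampleMean (fun m => ℓ z.2.2 (z.1 m)) -
        sampleMean fun m => ℓ z.2.2 (z.2.1 m)) ∂trainTestLaw D alg| := by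
  have gap_int := integrable_sampleMean_loss_sub (D := D) (alg := alg) hℓ hB bound
  rw [generalizationError, trainTestLaw, integral_prod_symm _ gap_int,
    Measure.integral_compProd gap_int.integral_prod_right]
  congr 2 with s
  have loss_int (w : W) : Integrable (ℓ w) D :=
    .of_bound (hℓ.comp measurable_prodMk_left).aestronglyMeasurable B (.of_forall (bound w))
  have train_mean : Measurable fun w => sampleMean fun m => ℓ w (s m) :=
    (measurable_sampleMean_loss hℓ).comp measurable_prodMk_right
  have fresh_int : Integrable (fun z : α × W => ℓ z.2 z.1 - sampleMean fun m => ℓ z.2 (s m))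
      (D.prod (alg s)) :=
    .of_bound ((hℓ.comp measurable_swap).sub
      (train_mean.comp measurable_snd)).aestronglyMeasurable (B + B) (.of_forall fun z =>
      (norm_sub_le _ _).trans (add_le_add (bound _ _) (norm_sampleMean_le hB fun m => bound _ _)))
  simp only [one_div, ← smul_eq_mul]
  refine (integral_integral_swap fresh_int).trans (integral_congr_ae (.of_forall fun w => ?_))
  dsimp only
  rw [integral_sub (loss_int w) (integrable_const _), integral_sub
    ((memLp_sampleMean (memLp_one_iff_integrable.2 (loss_int w))).integrable le_rfl)
    (integrable_const _), integral_sampleMean hn (loss_int w)]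
  simp [sampleMean]

end GeneralizationError

section ExpectedPermDiv

variable {α W κ : Type*} [MeasurableSpace α] [MeasurableSpace W] [MeasurableSpace κ] {n : ℕ}

/-- The expected relative entropy of the latent indices of the test and training samples, at the
learned parameters, with respect to their permutation symmetric mixture. -/
noncomputable def expectedPermDiv (D : Measure α) (enc : Kernel (W × α) κ)
    (alg : Kernel (Fin n → α) W) : ℝ≥0∞ :=
  ∫⁻ z, permDiv (fun i => enc (z.2.2, Fin.append z.1 z.2.1 i)) ∂trainTestLaw D alg

variable [Finite κ] [MeasurableSingletonClass κ] {D : Measure α} {enc : Kernel (W × α) κ}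
  [IsMarkovKernel enc] {alg : Kernel (Fin n → α) W}

lemma measurable_permDiv_encoder :
    Measurable fun z : W × (Fin n → α) => permDiv fun i => enc (z.1, z.2 i) :=
  measurable_permDiv fun i => enc.comap (fun z : W × (Fin n → α) => (z.1, z.2 i)) (by fun_prop)

lemma measurable_permDiv_encoder_append :
    Measurable fun z : (Fin n → α) × ((Fin n → α) × W) =>
      permDiv fun i => enc (z.2.2, Fin.append z.1 z.2.1 i) :=
  measurable_permDiv_encoder.comp
    (measurable_snd.snd.prodMk (measurable_append.comp (measurable_fst.prodMk measurable_snd.fst)))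

lemma integral_toReal_permDiv :
    ∫ z, (permDiv fun i => enc (z.2.2, Fin.append z.1 z.2.1 i)).toReal ∂trainTestLaw D alg =
      (expectedPermDiv D enc alg).toReal :=
  integral_toReal measurable_permDiv_encoder_append.aemeasurable
    (.of_forall fun _ => (permDiv_le _).trans_lt (by finiteness))

variable [IsProbabilityMeasure D] [IsMarkovKernel alg]

variable (D enc alg) in
lemma expectedPermDiv_ne_top : expectedPermDiv D enc alg ≠ ∞ := by
  refine ne_top_of_le_ne_top (b := ENNReal.ofReal (Real.log (n + n).factorial)) (by finiteness) ?_
  exact (lintegral_mono fun z => permDiv_le _).trans_eq (by simp)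

lemma integrable_toReal_permDiv :
    Integrable (fun z => (permDiv fun i => enc (z.2.2, Fin.append z.1 z.2.1 i)).toReal)
      (trainTestLaw D alg) :=
  integrable_toReal_of_lintegral_ne_top measurable_permDiv_encoder_append.aemeasurable
    (expectedPermDiv_ne_top D enc alg)

end ExpectedPermDiv

section Reconstruction

lemma norm_le_norm_add_sqrt {E : Type*} [NormedAddCommGroup E] {u v : E} {Δ : ℝ}
    (h : ‖u - v‖ ^ 2 ≤ Δ) : ‖v‖ ≤ ‖u‖ + √Δ :=
  (norm_le_norm_add_norm_sub u v).trans (by gcongr; exact Real.le_sqrt_of_sq_le h)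

lemma stronglyMeasurable_integral_kernel_of_finite {Ω κ F : Type*} [MeasurableSpace Ω]
    [MeasurableSpace κ] [Finite κ] [MeasurableSingletonClass κ] [NormedAddCommGroup F]
    [NormedSpace ℝ F] [CompleteSpace F] (q : Kernel Ω κ) [IsFiniteKernel q] {h : Ω → κ → F}
    (hh : ∀ j, StronglyMeasurable fun ω => h ω j) :
    StronglyMeasurable fun ω => ∫ j, h ω j ∂q ω := by
  have := Fintype.ofFinite κ
  simp only [integral_fintype Integrable.of_finite]
  refine Finset.stronglyMeasurable_fun_sum _ fun j _ => .smul ?_ (hh j)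
  exact (q.measurable_coe (.singleton j)).ennreal_toReal.stronglyMeasurable

variable {α W κ E : Type*} [MeasurableSpace α] [MeasurableSpace W] [MeasurableSpace κ]
  [NormedAddCommGroup E] {n : ℕ}

/-- The mean squared distance of the data point `f x` to its reconstruction `c w j`, where the
latent index `j` is drawn from the encoder. -/
noncomputable def reconstructionLoss (enc : Kernel (W × α) κ) (f : α → E) (c : W → κ → E) (w : W)
    (x : α) : ℝ :=
  ∫ j, ‖f x - c w j‖ ^ 2 ∂enc (w, x)

lemma reconstructionLoss_sub_const (enc : Kernel (W × α) κ) (f : α → E) (c : W → κ → E) (v : E) :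
    reconstructionLoss enc (fun x => f x - v) (fun w j => c w j - v) =
      reconstructionLoss enc f c := by
  ext w x
  simp only [reconstructionLoss, sub_sub_sub_cancel_right]

/-- The mean over a training sample of the expected reconstructions of its points. -/
noncomputable def meanReconstruction [NormedSpace ℝ E] (enc : Kernel (W × α) κ) (c : W → κ → E)
    (z : (Fin n → α) × W) : E :=
  sampleMean fun m => ∫ j, c z.2 j ∂enc (z.2, z.1 m)

variable {enc : Kernel (W × α) κ} [IsMarkovKernel enc] {f : α → E} {c : W → κ → E} {Δ : ℝ}

lemma norm_reconstructionLoss_le (hfc : ∀ x w j, ‖f x - c w j‖ ^ 2 ≤ Δ) (w : W) (x : α) :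
    ‖reconstructionLoss enc f c w x‖ ≤ Δ := by
  simpa [reconstructionLoss] using norm_integral_le_of_norm_le_const (μ := enc (w, x))
    (f := fun j => ‖f x - c w j‖ ^ 2) (.of_forall fun j => by simpa using hfc x w j)

lemma norm_meanReconstruction_le [NormedSpace ℝ E] {r : ℝ} (hr : 0 ≤ r) (hc : ∀ w j, ‖c w j‖ ≤ r)
    (z : (Fin n → α) × W) : ‖meanReconstruction enc c z‖ ≤ r :=
  norm_sampleMean_le hr fun _ => by
    simpa using norm_integral_le_of_norm_le_const (μ := enc _) (f := c z.2) (.of_forall (hc z.2))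

variable [Finite κ] [MeasurableSingletonClass κ]

lemma measurable_reconstructionLoss (hf : StronglyMeasurable f)
    (hc : ∀ j, StronglyMeasurable fun w => c w j) :
    Measurable (reconstructionLoss enc f c).uncurry :=
  (stronglyMeasurable_integral_kernel_of_finite enc (h := fun z j => ‖f z.2 - c z.1 j‖ ^ 2)
    fun j => (((hf.comp_measurable measurable_snd).sub
      ((hc j).comp_measurable measurable_fst)).norm.pow 2)).measurable

lemma stronglyMeasurable_meanReconstruction [NormedSpace ℝ E] [CompleteSpace E]
    (hc : ∀ j, StronglyMeasurable fun w => c w j) :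
    StronglyMeasurable (meanReconstruction (n := n) enc c) := by
  refine (Finset.stronglyMeasurable_fun_sum _ fun m _ => ?_).const_smul _
  exact stronglyMeasurable_integral_kernel_of_finite
    (enc.comap (fun z : (Fin n → α) × W => (z.2, z.1 m)) (by fun_prop))
    fun j => (hc j).comp_measurable measurable_snd

lemma memLp_meanReconstruction [NormedSpace ℝ E] [CompleteSpace E]
    (hc : ∀ j, StronglyMeasurable fun w => c w j) {y : E} (hy : ∀ w j, ‖y - c w j‖ ^ 2 ≤ Δ)
    (ν : Measure ((Fin n → α) × W)) [IsFiniteMeasure ν] :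
    MemLp (meanReconstruction enc c) 2 ν :=
  .of_bound (stronglyMeasurable_meanReconstruction hc).aestronglyMeasurable (‖y‖ + √Δ)
    (.of_forall (norm_meanReconstruction_le (by positivity) fun w j =>
      norm_le_norm_add_sqrt (hy w j)))

end Reconstruction

section GeneralizationBound

lemma sq_le_of_forall_mul_le {x k r : ℝ} (h : ∀ s : ℝ, s * x ≤ k + r * s ^ 2) :
    x ^ 2 ≤ 4 * r * k := by
  have := discrim_le_zero (a := r) (b := -x) (c := k) fun s => by linarith [h s]
  rw [discrim] at this
  linarith

lemma memLp_of_norm_sub_sq_le {α E : Type*} [MeasurableSpace α] [NormedAddCommGroup E]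
    {D : Measure α} [IsFiniteMeasure D] {f : α → E} {Δ : ℝ} {p : ℝ≥0∞}
    (hf : AEStronglyMeasurable f D) {y : E} (hy : ∀ x, ‖y - f x‖ ^ 2 ≤ Δ) : MemLp f p D :=
  .of_bound hf (‖y‖ + √Δ) (.of_forall fun x => norm_le_norm_add_sqrt (hy x))

variable {α W κ E : Type*} [MeasurableSpace α] [MeasurableSpace W] [MeasurableSpace κ]
  [NormedAddCommGroup E] [InnerProductSpace ℝ E] [CompleteSpace E] {n : ℕ} {D : Measure α}
  [IsProbabilityMeasure D] {f : α → E} {Δ : ℝ}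

lemma norm_sq_add_integral_norm_sq_le (hf : MemLp f 2 D) (centered : ∫ x, f x ∂D = 0) {y : E}
    (hy : ∀ x, ‖f x - y‖ ^ 2 ≤ Δ) : ‖y‖ ^ 2 + ∫ x, ‖f x‖ ^ 2 ∂D ≤ Δ := by
  have inner_int : Integrable (fun x => inner ℝ (f x) y) D :=
    (hf.integrable one_le_two).inner_const y
  have sq_int := hf.integrable_norm_pow two_ne_zero
  have inner_eq : ∫ x, inner ℝ (f x) y ∂D = 0 := by
    simp only [fun x => real_inner_comm y (f x)]
    rw [integral_inner (hf.integrable one_le_two), centered, inner_zero_right]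
  have steiner : ∫ x, ‖f x - y‖ ^ 2 ∂D = ‖y‖ ^ 2 + ∫ x, ‖f x‖ ^ 2 ∂D := by
    simp only [norm_sub_sq_real]
    rw [integral_add (by fun_prop) (by fun_prop), integral_sub (by fun_prop) (by fun_prop),
      integral_const_mul, inner_eq, integral_const, probReal_univ, one_smul]
    ring
  rw [← steiner]
  have dist_int : Integrable (fun x => ‖f x - y‖ ^ 2) D :=
    (hf.sub (memLp_const y)).integrable_norm_pow two_ne_zero
  simpa using integral_mono dist_int (integrable_const Δ) hy

variable [Finite κ] [MeasurableSingletonClass κ] {enc : Kernel (W × α) κ} [IsMarkovKernel enc]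
  {alg : Kernel (Fin n → α) W} [IsMarkovKernel alg] {c : W → κ → E}

lemma measurePreserving_fst_compProd (ν : Measure α) [SFinite ν] (η : Kernel α W)
    [IsMarkovKernel η] : MeasurePreserving Prod.fst (ν ⊗ₘ η) ν :=
  ⟨measurable_fst, Measure.fst_compProd ν η⟩

/-- Every reconstruction lies within `√Δ` of all data, so its squared norm is at most `Δ` minus the
variance of the data. Balancing the mean square of the sample mean against that of the
reconstruction therefore leaves only `Δ`. -/
lemma abs_integral_surrogateGap_meanReconstruction_le (hn : n ≠ 0) (hf : MemLp f 2 D)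
    (centered : ∫ x, f x ∂D = 0) (hc : ∀ j, StronglyMeasurable fun w => c w j)
    (hfc : ∀ x w j, ‖f x - c w j‖ ^ 2 ≤ Δ) :
    |∫ z, surrogateGap (fun m => f (z.1 m)) (fun m => f (z.2.1 m)) (meanReconstruction enc c z.2)
        ∂trainTestLaw D alg| ≤ Δ / √n := by
  set V := ∫ x, ‖f x‖ ^ 2 ∂D
  have bound (w : W) (j : κ) : ‖c w j‖ ^ 2 ≤ Δ - V :=
    le_sub_iff_add_le.2 (norm_sq_add_integral_norm_sq_le hf centered fun x => hfc x w j)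
  obtain ⟨x⟩ := nonempty_of_isProbabilityMeasure D
  have radius_nonneg : 0 ≤ Δ - V := by
    obtain ⟨z⟩ := nonempty_of_isProbabilityMeasure (trainTestLaw D alg)
    obtain ⟨j⟩ := nonempty_of_isProbabilityMeasure (enc (z.2.2, x))
    exact (sq_nonneg _).trans (bound z.2.2 j)
  have mean_memLp := memLp_meanReconstruction (enc := enc) hc (hfc x)
    ((Measure.pi fun _ : Fin n => D) ⊗ₘ alg)
  refine (abs_integral_surrogateGap_le hn (measurePreserving_fst_compProd _ alg) hf centered
    mean_memLp).trans ?_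
  gcongr
  rw [← le_sub_iff_add_le']
  refine (integral_mono (mean_memLp.integrable_norm_pow two_ne_zero) (integrable_const (Δ - V))
    fun z => ?_).trans_eq (by simp [V])
  exact (Real.le_sqrt (norm_nonneg _) radius_nonneg).1
    (norm_meanReconstruction_le (Real.sqrt_nonneg _)
      (fun w j => Real.le_sqrt_of_sq_le (bound w j)) z)

lemma mul_reconstructionGap_sub_surrogateGap_le (hff : ∀ x y, ‖f x - f y‖ ^ 2 ≤ Δ)
    (hfc : ∀ x w j, ‖f x - c w j‖ ^ 2 ≤ Δ) (hcc : ∀ w j j', ‖c w j - c w j'‖ ^ 2 ≤ Δ)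
    (hΔ : 0 ≤ Δ) (z : (Fin n → α) × ((Fin n → α) × W)) (s : ℝ) :
    s * (n * (sampleMean (fun m => reconstructionLoss enc f c z.2.2 (z.1 m)) -
        sampleMean (fun m => reconstructionLoss enc f c z.2.2 (z.2.1 m)) -
        surrogateGap (fun m => f (z.1 m)) (fun m => f (z.2.1 m)) (meanReconstruction enc c z.2))) ≤
      (permDiv fun i => enc (z.2.2, Fin.append z.1 z.2.1 i)).toReal + n * Δ ^ 2 * s ^ 2 := by
  simpa only [reconstructionLoss, meanReconstruction, Fin.append_left, Fin.append_right] using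
    mul_lossGap_sub_surrogateGap_le (fun i => enc (z.2.2, Fin.append z.1 z.2.1 i))
      (fun _ _ => hff _ _) (fun _ _ => hff _ _) (hcc z.2.2) (fun _ _ => hfc _ _ _) hΔ s

lemma abs_integral_reconstructionGap_sub_integral_surrogateGap_le (hn : n ≠ 0)
    (hf : StronglyMeasurable f) (hc : ∀ j, StronglyMeasurable fun w => c w j)
    (hff : ∀ x y, ‖f x - f y‖ ^ 2 ≤ Δ)
    (hfc : ∀ x w j, ‖f x - c w j‖ ^ 2 ≤ Δ) (hcc : ∀ w j j', ‖c w j - c w j'‖ ^ 2 ≤ Δ) :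
    |∫ z, (sampleMean (fun m => reconstructionLoss enc f c z.2.2 (z.1 m)) -
          sampleMean fun m => reconstructionLoss enc f c z.2.2 (z.2.1 m)) ∂trainTestLaw D alg -
        ∫ z, surrogateGap (fun m => f (z.1 m)) (fun m => f (z.2.1 m))
          (meanReconstruction enc c z.2) ∂trainTestLaw D alg| ≤
      2 * Δ * √((expectedPermDiv D enc alg).toReal / n) := by
  obtain ⟨x⟩ := nonempty_of_isProbabilityMeasure D
  have hΔ : 0 ≤ Δ := (sq_nonneg _).trans (hff x x)
  have loss_int := integrable_sampleMean_loss_sub (D := D) (alg := alg)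
    (measurable_reconstructionLoss (enc := enc) hf hc) hΔ (norm_reconstructionLoss_le hfc)
  have surrogate_int : Integrable (fun z => surrogateGap (fun m => f (z.1 m))
      (fun m => f (z.2.1 m)) (meanReconstruction enc c z.2)) (trainTestLaw D alg) :=
    integrable_surrogateGap (measurePreserving_fst_compProd _ alg)
      (memLp_of_norm_sub_sq_le hf.aestronglyMeasurable (hff x))
      (memLp_meanReconstruction (enc := enc) hc (hfc x) _)
  rw [← integral_sub loss_int surrogate_int]
  set A := ∫ z, (sampleMean (fun m => reconstructionLoss enc f c z.2.2 (z.1 m)) -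
    sampleMean (fun m => reconstructionLoss enc f c z.2.2 (z.2.1 m)) -
    surrogateGap (fun m => f (z.1 m)) (fun m => f (z.2.1 m)) (meanReconstruction enc c z.2))
      ∂trainTestLaw D alg
  have linear_bound (s : ℝ) :
      s * (n * A) ≤ (expectedPermDiv D enc alg).toReal + n * Δ ^ 2 * s ^ 2 := by
    have div_int := integrable_toReal_permDiv (D := D) (enc := enc) (alg := alg)
    rw [← integral_const_mul, ← integral_const_mul]
    refine (integral_mono (by fun_prop) (div_int.add (integrable_const (n * Δ ^ 2 * s ^ 2)))
      fun z => mul_reconstructionGap_sub_surrogateGap_le hff hfc hcc hΔ z s).trans_eq ?_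
    rw [Pi.add_def, integral_add div_int (integrable_const _), integral_toReal_permDiv]
    simp
  have sq_le : A ^ 2 ≤ (2 * Δ) ^ 2 * ((expectedPermDiv D enc alg).toReal / n) := by
    have hn' : 0 < (n : ℝ) := by positivity
    refine le_of_mul_le_mul_left ?_ (pow_pos hn' 2)
    rw [← mul_pow]
    refine (sq_le_of_forall_mul_le linear_bound).trans_eq ?_
    field_simp
    ring
  refine (Real.abs_le_sqrt sq_le).trans_eq ?_
  rw [Real.sqrt_mul (sq_nonneg _), Real.sqrt_sq (by positivity)]

lemma generalizationError_reconstructionLoss_le_of_centered (hn : n ≠ 0)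
    (hf : StronglyMeasurable f) (centered : ∫ x, f x ∂D = 0)
    (hc : ∀ j, StronglyMeasurable fun w => c w j) (hff : ∀ x y, ‖f x - f y‖ ^ 2 ≤ Δ)
    (hfc : ∀ x w j, ‖f x - c w j‖ ^ 2 ≤ Δ) (hcc : ∀ w j j', ‖c w j - c w j'‖ ^ 2 ≤ Δ) :
    generalizationError D (reconstructionLoss enc f c) alg ≤
      2 * Δ * √((expectedPermDiv D enc alg).toReal / n) + Δ / √n := by
  obtain ⟨x⟩ := nonempty_of_isProbabilityMeasure D
  have memLp : MemLp f 2 D := memLp_of_norm_sub_sq_le hf.aestronglyMeasurable (hff x)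
  have divergence_bound := abs_integral_reconstructionGap_sub_integral_surrogateGap_le
    (D := D) (enc := enc) (alg := alg) hn hf hc hff hfc hcc
  have variance_bound := abs_integral_surrogateGap_meanReconstruction_le
    (enc := enc) (alg := alg) hn memLp centered hc hfc
  rw [generalizationError_eq hn (measurable_reconstructionLoss hf hc)
    ((sq_nonneg _).trans (hff x x)) (norm_reconstructionLoss_le hfc)]
  linarith [abs_sub_abs_le_abs_sub
    (∫ z, (sampleMean (fun m => reconstructionLoss enc f c z.2.2 (z.1 m)) -
      sampleMean fun m => reconstructionLoss enc f c z.2.2 (z.2.1 m)) ∂trainTestLaw D alg)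
    (∫ z, surrogateGap (fun m => f (z.1 m)) (fun m => f (z.2.1 m))
      (meanReconstruction enc c z.2) ∂trainTestLaw D alg)]

end GeneralizationBound

section LatentIndices

open InformationTheory

variable {d dz dφ dθ K n : ℕ} {𝒳 : Set (EuclideanSpace ℝ (Fin d))}
  {𝒵 : Set (EuclideanSpace ℝ (Fin dz))} {Φ : Set (EuclideanSpace ℝ (Fin dφ))}
  {Θ : Set (EuclideanSpace ℝ (Fin dθ))}

lemma DiamLT.norm_sub_sq_le {Δ : ℝ} (h : DiamLT 𝒳 Δ) (x y : 𝒳) :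
    ‖(x : EuclideanSpace ℝ (Fin d)) - y‖ ^ 2 ≤ Δ := by
  have dist_le := (Metric.edist_le_ediam_of_mem x.2 y.2).trans h.2.le
  rw [edist_dist, ENNReal.ofReal_le_ofReal_iff (Real.sqrt_nonneg _), dist_eq_norm] at dist_le
  exact (Real.le_sqrt (norm_nonneg _) h.1.le).1 dist_le

variable (enc : Kernel (EncParam K 𝒵 Φ × 𝒳) (Fin K)) [IsMarkovKernel enc]

lemma jointPosterior_eq_map (p : EncParam K 𝒵 Φ) (x : Fin (n + n) → 𝒳)
    (T : Equiv.Perm (Fin (n + n))) :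
    jointPosterior enc p x T =
      (Measure.pi fun i => enc (p, x (T i))).map (Fin.appendEquiv n n).symm := by
  have split_append : (Fin.appendEquiv n n).symm ∘
      (fun z : (Fin n → Fin K) × (Fin n → Fin K) => Fin.append z.1 z.2) = id :=
    (Fin.appendEquiv n n).symm_comp_self
  rw [← (measurePreserving_append fun i => enc (p, x (T i))).map_eq,
    Measure.map_map (measurable_of_finite _) measurable_append, split_append, Measure.map_id]
  rfl

lemma permPrior_eq_map (p : EncParam K 𝒵 Φ) (x : Fin (n + n) → 𝒳) :
    permPrior enc p x =
      (permMixture fun i => enc (p, x i)).map (Fin.appendEquiv n n).symm := by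
  rw [permMixture, Measure.map_smul, Measure.map_finset_sum' (measurable_of_finite _).aemeasurable]
  simp only [permPrior, jointPosterior_eq_map]

lemma klDiv_jointPosterior (p : EncParam K 𝒵 Φ) (x : Fin (n + n) → 𝒳)
    (T : Equiv.Perm (Fin (n + n))) :
    klDiv (jointPosterior enc p x T) (permPrior enc p x) =
      permDiv fun i => enc (p, x (T i)) := by
  rw [jointPosterior_eq_map, permPrior_eq_map, permDiv,
    permMixture_comp_perm (fun i => enc (p, x i)) T]
  exact klDiv_map_of_leftInverse (measurable_of_finite _) (measurable_of_finite _)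
    (Fin.appendEquiv n n).right_inv

variable (D : Measure 𝒳) [IsProbabilityMeasure D]
  (alg : Kernel (Fin n → 𝒳) (Param K 𝒵 Φ Θ)) [IsMarkovKernel alg]

lemma expectedKL_eq_expectedPermDiv :
    expectedKL D enc alg =
      expectedPermDiv D (enc.comap (Prod.map Prod.fst id) (by fun_prop)) alg := by
  let F (x : Fin (n + n) → 𝒳) : ℝ≥0∞ :=
    ∫⁻ p, permDiv (fun i => enc (p, x i)) ∂alg.fst (trainData 1 x)
  have train_measurable : Measurable (trainData 1 : (Fin (n + n) → 𝒳) → Fin n → 𝒳) := by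
    unfold trainData
    fun_prop
  have F_measurable : Measurable F :=
    ((measurable_permDiv_encoder (enc := enc)).comp measurable_swap).lintegral_kernel_prod_right'
      (κ := alg.fst.comap _ train_measurable)
  have F_append_measurable : Measurable fun z : (Fin n → 𝒳) × (Fin n → 𝒳) =>
      F (Fin.append z.1 z.2) := F_measurable.comp measurable_append
  have F_append (s t : Fin n → 𝒳) :
      F (Fin.append s t) = ∫⁻ w, permDiv (fun i => enc (w.1, Fin.append s t i)) ∂alg t := by
    have : trainData 1 (Fin.append s t) = t := funext fun m => Fin.append_right s t m
    simp only [F, this]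
    exact Kernel.lintegral_fst _ _
      ((measurable_permDiv_encoder (enc := enc)).comp measurable_prodMk_right)
  simp only [expectedKL, klDiv_jointPosterior]
  refine (lintegral_average_perm D F_measurable).trans ?_
  rw [← (measurePreserving_append fun _ => D).lintegral_comp F_measurable,
    lintegral_prod _ F_append_measurable.aemeasurable, expectedPermDiv,
    trainTestLaw, lintegral_prod _ measurable_permDiv_encoder_append.aemeasurable]
  refine lintegral_congr fun s => .trans ?_ (Measure.lintegral_compProd
    (measurable_permDiv_encoder_append.comp measurable_prodMk_left)).symm
  exact lintegral_congr fun t => F_append s t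

end LatentIndices

end VQVAE

theorem theorem3_general {α W κ E : Type*} [MeasurableSpace α] [MeasurableSpace W]
    [MeasurableSpace κ] [Finite κ] [MeasurableSingletonClass κ] [NormedAddCommGroup E]
    [InnerProductSpace ℝ E] [CompleteSpace E] {n : ℕ} (hn : 1 ≤ n) {Δ : ℝ} {f : α → E}
    (hf : StronglyMeasurable f) {c : W → κ → E} (hc : ∀ j, StronglyMeasurable fun w => c w j)
    (hff : ∀ x y, ‖f x - f y‖ ^ 2 ≤ Δ) (hfc : ∀ x w j, ‖f x - c w j‖ ^ 2 ≤ Δ)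
    (hcc : ∀ w j j', ‖c w j - c w j'‖ ^ 2 ≤ Δ) (D : Measure α) [IsProbabilityMeasure D]
    (enc : Kernel (W × α) κ) [IsMarkovKernel enc] (alg : Kernel (Fin n → α) W)
    [IsMarkovKernel alg] :
    VQVAE.expectedPermDiv D enc alg ≠ ∞ ∧
      VQVAE.generalizationError D (VQVAE.reconstructionLoss enc f c) alg ≤
        2 * Δ * √((VQVAE.expectedPermDiv D enc alg).toReal / n) + Δ / √n := by
  refine ⟨VQVAE.expectedPermDiv_ne_top D enc alg, ?_⟩
  obtain ⟨x⟩ := nonempty_of_isProbabilityMeasure D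
  have f_int : Integrable f D := memLp_one_iff_integrable.1
    (VQVAE.memLp_of_norm_sub_sq_le hf.aestronglyMeasurable (hff x))
  rw [← VQVAE.reconstructionLoss_sub_const enc f c (∫ x, f x ∂D)]
  refine VQVAE.generalizationError_reconstructionLoss_le_of_centered (by omega)
    (hf.sub stronglyMeasurable_const) ?_ (fun j => (hc j).sub stronglyMeasurable_const)
    (fun x y => by simpa only [sub_sub_sub_cancel_right] using hff x y)
    (fun x w j => by simpa only [sub_sub_sub_cancel_right] using hfc x w j)
    fun w j j' => by simpa only [sub_sub_sub_cancel_right] using hcc w j j'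
  rw [integral_sub f_int (integrable_const _), integral_const, probReal_univ, one_smul, sub_self]

theorem theorem3 {d dz dφ dθ K n : ℕ} (hn : 1 ≤ n)
    (𝒳 : Set (EuclideanSpace ℝ (Fin d))) (𝒵 : Set (EuclideanSpace ℝ (Fin dz)))
    (Φ : Set (EuclideanSpace ℝ (Fin dφ))) (Θ : Set (EuclideanSpace ℝ (Fin dθ)))
    (Δ : ℝ) (hΔ : VQVAE.DiamLT 𝒳 Δ)
    (D : Measure 𝒳) [IsProbabilityMeasure D]
    (enc : Kernel (VQVAE.EncParam K 𝒵 Φ × 𝒳) (Fin K)) [IsMarkovKernel enc]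
    (g : Θ → 𝒵 → 𝒳) (hg : Measurable (Function.uncurry g))
    (alg : Kernel (Fin n → 𝒳) (VQVAE.Param K 𝒵 Φ Θ)) [IsMarkovKernel alg] :
    VQVAE.expectedKL D enc alg ≠ ∞ ∧
      VQVAE.genError D enc g alg ≤
        3 * Δ * Real.sqrt ((VQVAE.expectedKL D enc alg).toReal / n) + Δ / Real.sqrt n := by
  have decoder_measurable (j : Fin K) : StronglyMeasurable fun w : VQVAE.Param K 𝒵 Φ Θ =>
      (g w.2 (w.1.1 j) : EuclideanSpace ℝ (Fin d)) :=
    (measurable_subtype_coe.comp (hg.comp (f := fun w : VQVAE.Param K 𝒵 Φ Θ => (w.2, w.1.1 j))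
      (by fun_prop))).stronglyMeasurable
  rw [VQVAE.expectedKL_eq_expectedPermDiv]
  obtain ⟨finite, bound⟩ := theorem3_general hn measurable_subtype_coe.stronglyMeasurable
    decoder_measurable hΔ.norm_sub_sq_le (fun x w j => hΔ.norm_sub_sq_le x (g w.2 (w.1.1 j)))
    (fun w j j' => hΔ.norm_sub_sq_le (g w.2 (w.1.1 j)) (g w.2 (w.1.1 j'))) D
    (enc.comap (Prod.map Prod.fst id) (by fun_prop)) alg
  refine ⟨finite, LE.le.trans bound ?_⟩
  have := hΔ.1
  gcongr
  norm_num
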